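/- Let $a,c\in\mathbb{Z}$ and let $k,m,n\in\mathbb{N}$ with $km>n\ge 1$. Suppose that $$\mathcal F(z)=(z^k+c)^m-az^n$$ is irreducible over $\mathbb{Q}$, let $\theta\in\mathbb{C}$ be a root of $\mathcal F$, and suppose that $K=\mathbb{Q}(\theta)$ is the splitting field of $\mathcal F$ over $\mathbb{Q}$. Put $t=\gcd(n,k)$, $n_1=n/t$, $k_1=k/t$, $\mathcal C=(km)^{k_1m}c^{k_1m-n_1}$ and $\mathcal E=a^{k_1}n^{n_1}(km-n)^{k_1m-n_1}$. Suppose that every prime $p$ dividing the discriminant of $\mathcal F$ satisfies the requirement of that one of the following (mutually exclusive) cases to which it belongs: (i) $p\mid c$ and $p\mid a$: then $m=1$ and $p^2\nmid c$. (ii) $p\mid c$, $p\nmid a$ and $n=1$: with $j\ge 1$ such that $p^j$ is the highest power of $p$ dividing $km-1$, $c_2=\frac cp$ and $a_1=\frac{a^{p^j}-a}{p}$, either $p\mid c_2$ and $p\nmid a_1$, or $p\nmid c_2\,[a^k a_1^{km-1}-(-mac_2)^{km-1}]$. (iii) $p\mid c$, $p\nmid a$ and $n\ge 2$: then $m=1$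 and, with $\ell\ge 0$ such that $p^\ell$ is the highest power of $p$ dividing $k-n$, $c_2=\frac cp$ and $a_1=\frac{a^{p^\ell}-a}{p}$, either $p\mid a_1$ and $p\nmid c_2$, or $p\nmid a_1c_2^{\,n-1}[a^{n_1}a_1^{k_1-n_1}-(-c_2)^{k_1-n_1}]$. (iv) $p\nmid c$ and $p\mid a$: if $m\ge 2$, then $p^2\nmid a$; if $m=1$, then, with $\ell\ge 1$ such that $p^\ell$ is the highest power of $p$ dividing $k$, $a_2=-\frac ap$ and $c_1=\frac{(-c)^{p^\ell}+c}{p}$, either $p\mid a_2$ and $p\nmid c_1$, or $p\nmid a_2\,[a_2^{k_1}(-c)^{n_1}-(-c_1)^{k_1}]$. (v) $p\nmid ca$ and $p\mid k$: writing $k=p^js'$ and $n=p^js$ with $p\nmid\gcd(s,s')$, $a_1=\frac{a^{p^j}-a}{p}$ and $t(x)=\frac1p\Bigl(\sum_{i=0}^{p^j-1}\binom{p^j}{i}x^{s'i}c^{p^j-i}-c\Bigr)\in\mathbb{Z}[x]$, the polynomials $a_1x^n-m\,t(x)(x^k+c)^{m-1}$ and $(x^{s'}+c)^m-ax^s$ are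 coprime modulo $p$. (vi) $p\nmid cak$ and $p\mid m$: then $p\mid n$ and $p^2\nmid a^p-a$. (vii) $p\nmid cakm$: then $p^2\nmid \mathcal C-\mathcal E$. Then there are integers $c^{(i)}_{j-1}$ $(1\le i,j\le km)$ such that the following hold. (1) The numbers $\sum_{j=1}^{km}c^{(i)}_{j-1}\theta^{j-1}$, $1\le i\le km$, are exactly the roots of $\mathcal F$: $\mathcal F(z)=\prod_{i=1}^{km}\bigl(z-\sum_{j=1}^{km}c^{(i)}_{j-1}\theta^{j-1}\bigr)$. (2) The general solution of the differential equation $$\Bigl(\frac{d^k}{dx^k}+c\Bigr)^m y-a\frac{d^ny}{dx^n}=0$$ on $\mathbb{R}$ is $$y(x)=\sum_{i=1}^{km}\alpha_i\prod_{j=1}^{km}e^{c^{(i)}_{j-1}\theta^{j-1}x}$$ with arbitrary constants $\alpha_i$. That is, a $km$ times differentiable function $y:\mathbb{R}\to\mathbb{C}$ is a solution if and only if it has this form with some $\alpha_1,\dots,\alpha_{km}\in\mathbb{C}$; and if $\theta$ is real, a $km$ times differentiable function $y:\mathbb{R}\to\mathbb{R}$ is a solution if and only if it has this form with some $\alpha_1,\dots,\alpha_{km}\in\mathbb{R}$.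 -/

import Mathlib

open Polynomial

/-- The auxiliary polynomial `(z ^ k + c) ^ m - a * z ^ n` with integer coefficients. -/
noncomputable def auxPoly (a c : ℤ) (m n k : ℕ) : ℤ[X] :=
  (X ^ k + C c) ^ m - C a * X ^ n

/-- The operator `y ↦ d^k y / dx^k + c y` on functions of a real variable. -/
noncomputable def diffOp {𝕜 : Type*} [RCLike 𝕜] (k : ℕ) (c : ℤ) (y : ℝ → 𝕜) : ℝ → 𝕜 :=
  fun x => iteratedDeriv k y x + (c : 𝕜) * y x

/-- `y` is a (classical) solution on the real line of
`(d^k/dx^k + c)^m y - a d^n y/dx^n = 0`: it is `km` times differentiable and satisfies the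
equation at every point. -/
def IsODESolution {𝕜 : Type*} [RCLike 𝕜] (a c : ℤ) (m n k : ℕ) (y : ℝ → 𝕜) : Prop :=
  (∀ i < k * m, Differentiable ℝ (iteratedDeriv i y)) ∧
    ∀ x : ℝ, ((diffOp k c)^[m] y) x - (a : 𝕜) * iteratedDeriv n y x = 0

/-- `p ∣ c`, `p ∣ a`, and `m = 1`, `p² ∤ c`. -/
def CondI (a c : ℤ) (m p : ℕ) : Prop :=
  (p : ℤ) ∣ c ∧ (p : ℤ) ∣ a ∧ m = 1 ∧ ¬ (p : ℤ) ^ 2 ∣ c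

/-- The condition for `p ∣ c`, `p ∤ a`, `n = 1`. Here `j`, `c₂`, `a₁` are given by equations;
both divisions by `p` are exact. -/
def CondII (a c : ℤ) (m n k p : ℕ) : Prop :=
  (p : ℤ) ∣ c ∧ ¬ (p : ℤ) ∣ a ∧ n = 1 ∧
    ∃ (j : ℕ) (c₂ a₁ : ℤ), j = padicValNat p (k * m - 1) ∧ 1 ≤ j ∧
      c₂ = c / p ∧ a₁ = (a ^ p ^ j - a) / p ∧
      (((p : ℤ) ∣ c₂ ∧ ¬ (p : ℤ) ∣ a₁) ∨
        ¬ (p : ℤ) ∣ c₂ * (a ^ k * a₁ ^ (k * m - 1) - (-(m * a * c₂)) ^ (k * m - 1)))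

/-- The condition for `p ∣ c`, `p ∤ a`, `n ≥ 2`. -/
def CondIII (a c : ℤ) (m n k p : ℕ) : Prop :=
  (p : ℤ) ∣ c ∧ ¬ (p : ℤ) ∣ a ∧ 2 ≤ n ∧ m = 1 ∧
    ∃ (l n₁ k₁ : ℕ) (c₂ a₁ : ℤ), l = padicValNat p (k - n) ∧
      n₁ = n / Nat.gcd n k ∧ k₁ = k / Nat.gcd n k ∧
      c₂ = c / p ∧ a₁ = (a ^ p ^ l - a) / p ∧
      (((p : ℤ) ∣ a₁ ∧ ¬ (p : ℤ) ∣ c₂) ∨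
        ¬ (p : ℤ) ∣ a₁ * c₂ ^ (n - 1) * (a ^ n₁ * a₁ ^ (k₁ - n₁) - (-c₂) ^ (k₁ - n₁)))

/-- The condition for `p ∤ c`, `p ∣ a`, with the two cases `m ≥ 2` and `m = 1`. -/
def CondIV (a c : ℤ) (m n k p : ℕ) : Prop :=
  ¬ (p : ℤ) ∣ c ∧ (p : ℤ) ∣ a ∧
    ((2 ≤ m ∧ ¬ (p : ℤ) ^ 2 ∣ a) ∨
      (m = 1 ∧ ∃ (l n₁ k₁ : ℕ) (a₂ c₁ : ℤ), l = padicValNat p k ∧ 1 ≤ l ∧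
        n₁ = n / Nat.gcd n k ∧ k₁ = k / Nat.gcd n k ∧
        a₂ = -(a / p) ∧ c₁ = ((-c) ^ p ^ l + c) / p ∧
        (((p : ℤ) ∣ a₂ ∧ ¬ (p : ℤ) ∣ c₁) ∨
          ¬ (p : ℤ) ∣ a₂ * (a₂ ^ k₁ * (-c) ^ n₁ - (-c₁) ^ k₁))))

/-- The condition for `p ∤ ca`, `p ∣ k`: with `k = p ^ j * s'`, `n = p ^ j * s` and
`p ∤ gcd(s, s')`, the polynomials `a₁ x^n - m t(x) (x^k + c)^(m-1)` and
`(x^s' + c)^m - a x^s` are coprime modulo `p`. The integer polynomial `T` is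
`t(x) = (1/p) (∑_{i < p^j} binom(p^j, i) x^(s' i) c^(p^j - i) - c)`. -/
def CondV (a c : ℤ) (m n k p : ℕ) : Prop :=
  ¬ (p : ℤ) ∣ c * a ∧ p ∣ k ∧
    ∃ (j s s' : ℕ) (a₁ : ℤ) (T : ℤ[X]), k = p ^ j * s' ∧ n = p ^ j * s ∧
      ¬ p ∣ Nat.gcd s s' ∧ a₁ = (a ^ p ^ j - a) / p ∧
      C (p : ℤ) * T =
        (∑ i ∈ Finset.range (p ^ j),
          C (((p ^ j).choose i : ℤ) * c ^ (p ^ j - i)) * X ^ (s' * i)) - C c ∧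
      IsCoprime
        ((C a₁ * X ^ n - C (m : ℤ) * T * (X ^ k + C c) ^ (m - 1)).map
          (Int.castRingHom (ZMod p)))
        (((X ^ s' + C c) ^ m - C a * X ^ s).map (Int.castRingHom (ZMod p)))

/-- The condition for `p ∤ cak`, `p ∣ m`. -/
def CondVI (a c : ℤ) (m n k p : ℕ) : Prop :=
  ¬ (p : ℤ) ∣ c * a * k ∧ p ∣ m ∧ p ∣ n ∧ ¬ (p : ℤ) ^ 2 ∣ a ^ p - a

/-- The condition for `p ∤ cakm`: `p² ∤ 𝒞 - ℰ`, where `𝒞 = (km)^(k₁m) c^(k₁m - n₁)` and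
`ℰ = a^k₁ n^n₁ (km - n)^(k₁m - n₁)`. -/
def CondVII (a c : ℤ) (m n k p : ℕ) : Prop :=
  ¬ (p : ℤ) ∣ c * a * k * m ∧
    ∃ n₁ k₁ : ℕ, n₁ = n / Nat.gcd n k ∧ k₁ = k / Nat.gcd n k ∧
      ¬ (p : ℤ) ^ 2 ∣ ((k : ℤ) * m) ^ (k₁ * m) * c ^ (k₁ * m - n₁)
        - a ^ k₁ * (n : ℤ) ^ n₁ * ((k : ℤ) * m - n) ^ (k₁ * m - n₁)

/-- `p` falls under one of the seven (mutually exclusive) cases and satisfies the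
requirement of that case. -/
def SatisfiesCond (a c : ℤ) (m n k p : ℕ) : Prop :=
  CondI a c m p ∨ CondII a c m n k p ∨ CondIII a c m n k p ∨ CondIV a c m n k p ∨
    CondV a c m n k p ∨ CondVI a c m n k p ∨ CondVII a c m n k p

/-! The arithmetic content is that every root of F lies in ℤ[θ]. The roots are integral and lie in K
= ℚ(θ), so it suffices that ℤ[θ] is integrally closed. This holds as soon as the monic F lies in the
square of no maximal ideal of ℤ[X] (`isIntegrallyClosed_adjoin_of_notMem_sq`): each maximal ideal of
ℤ[θ] has two generators, and the relation F = 0, coming from outside the square, makes one of them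
redundant locally.

If F ∈ I² with p ∈ I, then F' ∈ I, so the discriminant lies in I, p divides it, and one of the seven
conditions applies. The class x of X in ℤ[X]/I² satisfies F(x) = 0, and its residue in ℤ[X]/I is
also a root of F'. Elements with equal residues have equal p^j-th powers for j ≥ 1; this typically
turns F(x) = 0 into p·h(x) = 0. Only elements of the kernel are killed by p, so h vanishes at the
residue of x, which the condition excludes (`IsSquareZeroThickening.not_satisfiesCond`).

For the equation, F is irreducible, so its roots r_i are distinct. Their Lagrange basis polynomials
L_i sum to 1, so y = ∑ L_i(d/dx) y, and each summand solves f' = r_i f. -/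

/-- `φ : S → κ` is a square-zero extension of a field, in which multiplication by `p` has no more
kernel than it must have. The example is `ℤ[X] ⧸ 𝔪 ^ 2 → ℤ[X] ⧸ 𝔪` with `p ∈ 𝔪`. -/
structure IsSquareZeroThickening {S κ : Type*} [CommRing S] [Field κ] (p : ℕ) (φ : S →+* κ) :
    Prop where
  mul_of_ker : ∀ u v : S, φ u = 0 → φ v = 0 → u * v = 0
  of_natCast_mul : ∀ s : S, (p : S) * s = 0 → φ s = 0

/-! ### Arithmetic in a square-zero thickening. -/

namespace IsSquareZeroThickening

variable {S κ : Type*} [CommRing S] [Field κ] {p : ℕ} {φ : S →+* κ}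

lemma natCast_mul [CharP κ p] (h : IsSquareZeroThickening p φ) {w : S} (hw : φ w = 0) :
    (p : S) * w = 0 :=
  h.mul_of_ker _ _ (by simp) hw

lemma pow_add_ker (h : IsSquareZeroThickening p φ) (v : S) {w : S} (hw : φ w = 0) (N : ℕ) :
    (v + w) ^ N = v ^ N + N * v ^ (N - 1) * w := by
  have hww := h.mul_of_ker w w hw hw
  induction N with
  | zero => simp
  | succ N ih =>
    rw [pow_succ, ih]
    rcases N with _ | N
    · simp
    · simp only [Nat.add_sub_cancel, pow_succ]
      push_cast
      linear_combination ((N : S) + 1) * v ^ N * hww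

/-- The linear term of the binomial expansion carries the factor p^j, and p already kills the
kernel. -/
lemma pow_eq_pow [Fact p.Prime] [CharP κ p] (h : IsSquareZeroThickening p φ) {u v : S}
    (huv : φ u = φ v) {j : ℕ} (hj : 1 ≤ j) : u ^ p ^ j = v ^ p ^ j := by
  have hw : φ (u - v) = 0 := by simp [huv]
  have h1 := h.pow_add_ker v hw (p ^ j)
  obtain ⟨i, rfl⟩ : ∃ i, j = i + 1 := ⟨j - 1, by omega⟩
  have h2 := h.natCast_mul hw
  rw [add_sub_cancel] at h1
  rw [h1]
  push_cast
  linear_combination (p : S) ^ i * v ^ (p ^ (i + 1) - 1) * h2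

/-- This is how divisibility by p² is detected: an integer divisible by p that vanishes in S is
divisible by p². -/
lemma natCast_mul_intCast [CharP κ p] (h : IsSquareZeroThickening p φ) {z : ℤ}
    (hz : ((p * z : ℤ) : S) = 0) : (p : ℤ) ∣ z := by
  rw [← CharP.intCast_eq_zero_iff κ p z]
  have := h.of_natCast_mul (z : S) (by push_cast at hz; exact hz)
  simpa using this

end IsSquareZeroThickening

lemma pow_prime_pow_injective {κ : Type*} [Field κ] {p : ℕ} [Fact p.Prime] [CharP κ p] (j : ℕ)
    {u v : κ} (h : u ^ p ^ j = v ^ p ^ j) : u = v := by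
  apply (iterateFrobenius κ p j).injective
  simpa [iterateFrobenius_def] using h

lemma intCast_pow_prime_pow (κ : Type*) [Field κ] (p : ℕ) [Fact p.Prime] [CharP κ p] (j : ℕ)
    (a : ℤ) : (a : κ) ^ p ^ j = a := by
  rw [← iterateFrobenius_def, map_intCast]

lemma dvd_pow_prime_pow_sub {p : ℕ} (hp : p.Prime) (j : ℕ) (a : ℤ) :
    (p : ℤ) ∣ a ^ p ^ j - a := by
  have := Fact.mk hp
  rw [← CharP.intCast_eq_zero_iff (ZMod p) p]
  push_cast
  rw [intCast_pow_prime_pow, sub_self]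

/-! ### The seven conditions each exclude a singular point over p. -/

section Cases

variable {S κ : Type*} [CommRing S] [Field κ] {p : ℕ} [CharP κ p] {φ : S →+* κ}

lemma IsSquareZeroThickening.false_of_condI (h : IsSquareZeroThickening p φ) {a c : ℤ}
    {m n k : ℕ} (hn : 1 ≤ n) (hkm : n < k * m) {x : S}
    (hF : (x ^ k + c) ^ m - a * x ^ n = 0) (hc : CondI a c m p) : False := by
  obtain ⟨hpc, hpa, rfl, hpc2⟩ := hc
  obtain ⟨c₂, rfl⟩ := hpc
  obtain ⟨a₂, rfl⟩ := hpa
  have hk : k ≠ 0 := by rintro rfl; simp at hkm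
  have hx : φ x = 0 := by
    have := congrArg φ hF
    simpa [hk] using this
  have e1 : (p : S) * x = 0 := h.natCast_mul hx
  have e2 : x * x = 0 := h.mul_of_ker x x hx hx
  -- Here m = 1, so k > n ≥ 1. Every term of F(x) except c then vanishes in S.
  obtain ⟨k', rfl⟩ : ∃ i, k = i + 2 := ⟨k - 2, by omega⟩
  obtain ⟨n', rfl⟩ : ∃ i, n = i + 1 := ⟨n - 1, by omega⟩
  apply hpc2
  rw [sq]
  refine mul_dvd_mul_left _ (h.natCast_mul_intCast ?_)
  push_cast at hF ⊢
  linear_combination hF - x ^ k' * e2 + a₂ * x ^ n' * e1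

variable [Fact p.Prime]

lemma IsSquareZeroThickening.false_of_condII (h : IsSquareZeroThickening p φ) {a c : ℤ}
    {m n k : ℕ} (hkm : n < k * m) {x : S}
    (hF : (x ^ k + c) ^ m - a * x ^ n = 0)
    (hF' : (k * m * φ x ^ (k - 1) * (φ x ^ k + c) ^ (m - 1) - n * a * φ x ^ (n - 1) : κ) = 0)
    (hc : CondII a c m n k p) : False := by
  have hp : p.Prime := Fact.out
  obtain ⟨hpc, hpa, rfl, j, c₂, a₁, hj, hj1, hc₂, ha₁, hcase⟩ := hc
  have ha₁' : (p : ℤ) * a₁ = a ^ p ^ j - a := by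
    rw [ha₁, Int.mul_ediv_cancel' (dvd_pow_prime_pow_sub hp j a)]
  have hc₂' : (p : ℤ) * c₂ = c := by rw [hc₂, Int.mul_ediv_cancel' hpc]
  clear hc₂ ha₁
  have hk : k ≠ 0 := by rintro rfl; simp at hkm
  have hm : m ≠ 0 := by rintro rfl; simp at hkm
  have hcκ : (c : κ) = 0 := (CharP.intCast_eq_zero_iff κ p c).2 hpc
  have haκ : (a : κ) ≠ 0 := fun h0 => hpa ((CharP.intCast_eq_zero_iff κ p a).1 h0)
  have hκ : φ x * φ x ^ (k * m - 1) = φ x * a := by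
    have := congrArg φ hF
    rw [← pow_succ', Nat.sub_add_cancel (by omega), pow_mul, mul_comm (φ x)]
    simpa [hcκ, sub_eq_zero] using this
  -- At 0 the derivative would be -a, since n = 1 and km > 1.
  have hx : φ x ≠ 0 := by
    intro h0
    rw [h0, hcκ, add_zero, zero_pow hk] at hF'
    rcases Nat.lt_or_ge 1 k with h1 | h1
    · rw [zero_pow (by omega : k - 1 ≠ 0)] at hF'
      simp [haκ] at hF'
    · obtain rfl : k = 1 := by omega
      rw [zero_pow (by omega : m - 1 ≠ 0)] at hF'
      simp [haκ] at hF'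
  have hN : φ x ^ (k * m - 1) = a := mul_left_cancel₀ hx hκ
  obtain ⟨u, hu⟩ : p ^ j ∣ k * m - 1 := hj ▸ pow_padicValNat_dvd
  have hxu : φ (x ^ u) = φ (a : S) := by
    apply pow_prime_pow_injective (p := p) j
    rw [map_pow, ← pow_mul, mul_comm, ← hu, hN, map_intCast, intCast_pow_prime_pow]
  have hxN : x ^ (k * m - 1) = a + p * a₁ := by
    rw [hu, mul_comm, pow_mul, h.pow_eq_pow hxu hj1]
    have := congrArg (Int.cast : ℤ → S) ha₁'
    push_cast at this
    linear_combination -this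
  have hxkm : (x ^ k) ^ m = x * x ^ (k * m - 1) := by
    rw [← pow_succ', Nat.sub_add_cancel (by omega), pow_mul]
  -- Both x^(km) and (x^k + c)^m are now known to first order, so F(x) is p times this element up to
  -- sign.
  have hrel : φ (a₁ * x + m * c₂ * x ^ (k * (m - 1))) = 0 := by
    apply h.of_natCast_mul
    rw [h.pow_add_ker (x ^ k) (w := (c : S)) (by simpa using hcκ), hxkm, hxN, ← pow_mul, ← hc₂'] at hF
    push_cast at hF
    linear_combination hF
  simp only [map_add, map_mul, map_pow, map_intCast, map_natCast] at hrel
  have hrel2 : (a₁ * φ x ^ k : κ) = -(m * a * c₂) := by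
    have e1 : φ x ^ k = φ x * φ x ^ (k - 1) := by rw [← pow_succ', Nat.sub_add_cancel (by omega)]
    have e2 : φ x ^ (k * (m - 1)) * φ x ^ (k - 1) = a := by
      rw [← pow_add, ← hN]
      congr 1
      obtain ⟨i, rfl⟩ : ∃ i, m = i + 1 := ⟨m - 1, by omega⟩
      rw [Nat.add_sub_cancel, mul_add, mul_one]
      omega
    rw [e1]
    linear_combination φ x ^ (k - 1) * hrel - m * c₂ * e2
  rcases hcase with ⟨h1, h2⟩ | h1
  · rw [(CharP.intCast_eq_zero_iff κ p c₂).2 h1, mul_zero, neg_zero] at hrel2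
    rcases mul_eq_zero.1 hrel2 with h3 | h3
    · exact h2 ((CharP.intCast_eq_zero_iff κ p a₁).1 h3)
    · exact hx (by simpa [hk] using h3)
  · apply h1
    rw [← CharP.intCast_eq_zero_iff κ p]
    push_cast
    -- The (km-1)-th power of `hrel2` eliminates x, because x^(km-1) = a in κ.
    rw [← hrel2, mul_pow, pow_right_comm, hN]
    ring

lemma IsSquareZeroThickening.false_of_condIII (h : IsSquareZeroThickening p φ) {a c : ℤ}
    {m n k : ℕ} (hkm : n < k * m) {x : S}
    (hF : (x ^ k + c) ^ m - a * x ^ n = 0)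
    (hF' : (k * m * φ x ^ (k - 1) * (φ x ^ k + c) ^ (m - 1) - n * a * φ x ^ (n - 1) : κ) = 0)
    (hc : CondIII a c m n k p) : False := by
  have hp : p.Prime := Fact.out
  obtain ⟨hpc, hpa, hn2, rfl, l, n₁, k₁, c₂, a₁, hl, hn₁, hk₁, hc₂, ha₁, hcase⟩ := hc
  have ha₁' : (p : ℤ) * a₁ = a ^ p ^ l - a := by
    rw [ha₁, Int.mul_ediv_cancel' (dvd_pow_prime_pow_sub hp l a)]
  have hc₂' : (p : ℤ) * c₂ = c := by rw [hc₂, Int.mul_ediv_cancel' hpc]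
  clear hc₂ ha₁
  rw [mul_one] at hkm
  have hcκ : (c : κ) = 0 := (CharP.intCast_eq_zero_iff κ p c).2 hpc
  have haκ : (a : κ) ≠ 0 := fun h0 => hpa ((CharP.intCast_eq_zero_iff κ p a).1 h0)
  have hc₂' : (p : S) * c₂ = c := by rw [← hc₂']; push_cast; rfl
  rw [pow_one] at hF
  have hκ : φ x ^ k = a * φ x ^ n := by
    have := congrArg φ hF
    simpa [hcκ, sub_eq_zero] using this
  -- As n ≥ 2, the residue 0 is possible here; then x² = 0 reduces F(x) = 0 to c = 0 in S.
  by_cases hx : φ x = 0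
  · have hpc₂ : (p : ℤ) ∣ c₂ := by
      apply h.natCast_mul_intCast
      obtain ⟨k', rfl⟩ : ∃ i, k = i + 2 := ⟨k - 2, by omega⟩
      obtain ⟨n', rfl⟩ : ∃ i, n = i + 2 := ⟨n - 2, by omega⟩
      have e2 : x * x = 0 := h.mul_of_ker x x hx hx
      push_cast
      linear_combination hF - (x ^ k' - a * x ^ n') * e2 + hc₂'
    rcases hcase with ⟨h1, h2⟩ | h1
    · exact h2 hpc₂
    · exact h1 (((hpc₂.pow (by omega)).mul_left _).mul_right _)
  have hxk : φ x ^ k = φ x ^ n * φ x ^ (k - n) := by rw [← pow_add]; congr 1; omega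
  have hN : φ x ^ (k - n) = a := by
    apply mul_left_cancel₀ (pow_ne_zero n hx)
    rw [← hxk, hκ, mul_comm]
  -- Combining x·F'(x) = 0 with x^k = a·x^n in κ leaves (k - n)·a·x^n = 0.
  have hdvd : p ∣ k - n := by
    rw [← CharP.cast_eq_zero_iff κ p, Nat.cast_sub hkm.le]
    have e1 : φ x ^ k = φ x * φ x ^ (k - 1) := by rw [← pow_succ', Nat.sub_add_cancel (by omega)]
    have e2 : φ x ^ n = φ x * φ x ^ (n - 1) := by rw [← pow_succ', Nat.sub_add_cancel (by omega)]
    apply eq_zero_of_ne_zero_of_mul_right_eq_zero (mul_ne_zero haκ (pow_ne_zero n hx))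
    simp only [Nat.sub_self, pow_zero, Nat.cast_one] at hF'
    linear_combination φ x * hF' - k * hκ + k * e1 - n * a * e2
  have hl1 : 1 ≤ l := hl ▸ one_le_padicValNat_of_dvd (by omega) hdvd
  obtain ⟨u, hu⟩ : p ^ l ∣ k - n := hl ▸ pow_padicValNat_dvd
  have hxu : φ (x ^ u) = φ (a : S) := by
    apply pow_prime_pow_injective (p := p) l
    rw [map_pow, ← pow_mul, mul_comm, ← hu, hN, map_intCast, intCast_pow_prime_pow]
  have hxN : x ^ (k - n) = a + p * a₁ := by
    rw [hu, mul_comm, pow_mul, h.pow_eq_pow hxu hl1]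
    have := congrArg (Int.cast : ℤ → S) ha₁'
    push_cast at this
    linear_combination -this
  have hrel : φ (a₁ * x ^ n + c₂) = 0 := by
    apply h.of_natCast_mul
    have e : x ^ k = x ^ n * x ^ (k - n) := by rw [← pow_add]; congr 1; omega
    rw [e, hxN, ← hc₂'] at hF
    linear_combination hF
  simp only [map_add, map_mul, map_pow, map_intCast] at hrel
  rcases hcase with ⟨h1, h2⟩ | h1
  · apply h2
    rw [← CharP.intCast_eq_zero_iff κ p]
    rwa [(CharP.intCast_eq_zero_iff κ p a₁).2 h1, zero_mul, zero_add] at hrel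
  · apply h1
    refine Dvd.dvd.mul_left ?_ _
    rw [← CharP.intCast_eq_zero_iff κ p]
    push_cast
    -- This exponent is a common multiple of n and k - n, so x can be eliminated between x^(k-n) = a
    -- and a₁x^n = -c₂.
    have e : n * (k₁ - n₁) = (k - n) * n₁ := by
      have h1 : n₁ * n.gcd k = n := hn₁ ▸ Nat.div_mul_cancel (Nat.gcd_dvd_left n k)
      have h2 : k₁ * n.gcd k = k := hk₁ ▸ Nat.div_mul_cancel (Nat.gcd_dvd_right n k)
      calc n * (k₁ - n₁) = n₁ * n.gcd k * (k₁ - n₁) := by rw [h1]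
        _ = (k₁ * n.gcd k - n₁ * n.gcd k) * n₁ := by rw [← Nat.sub_mul]; ring
        _ = _ := by rw [h1, h2]
    rw [← eq_neg_of_add_eq_zero_left hrel, mul_pow, ← pow_mul, e, pow_mul, hN]
    ring

lemma IsSquareZeroThickening.false_of_condIV (h : IsSquareZeroThickening p φ) {a c : ℤ}
    {m n k : ℕ} (hkm : n < k * m) {x : S}
    (hF : (x ^ k + c) ^ m - a * x ^ n = 0)
    (hc : CondIV a c m n k p) : False := by
  have hp : p.Prime := Fact.out
  obtain ⟨hpc, hpa, hcase⟩ := hc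
  have hk : k ≠ 0 := by rintro rfl; simp at hkm
  have hm : m ≠ 0 := by rintro rfl; simp at hkm
  have haκ : (a : κ) = 0 := (CharP.intCast_eq_zero_iff κ p a).2 hpa
  have hcκ : (c : κ) ≠ 0 := fun h0 => hpc ((CharP.intCast_eq_zero_iff κ p c).1 h0)
  have hκ : φ (x ^ k + c) = 0 := by
    have := congrArg φ hF
    simpa [haκ, hm] using this
  have hx : φ x ≠ 0 := by
    intro h0
    simp [h0, hk, hcκ] at hκ
  obtain ⟨a', rfl⟩ := hpa
  rcases hcase with ⟨hm2, hpa⟩ | ⟨rfl, l, n₁, k₁, a₂, c₁, hl, hl1, hn₁, hk₁, ha₂, hc₁, hcase⟩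
  · apply hpa
    rw [sq]
    apply mul_dvd_mul_left
    obtain ⟨m', rfl⟩ : ∃ i, m = i + 2 := ⟨m - 2, by omega⟩
    have e2 := h.mul_of_ker _ _ hκ hκ
    have : φ (a' * x ^ n) = 0 := by
      apply h.of_natCast_mul
      push_cast at hF
      linear_combination (x ^ k + c) ^ m' * e2 - hF
    rw [← CharP.intCast_eq_zero_iff κ p]
    simpa [hx] using this
  · have hc₁' : (p : ℤ) * c₁ = (-c) ^ p ^ l + c := by
      have := dvd_pow_prime_pow_sub hp l (-c)
      rw [sub_neg_eq_add] at this
      rw [hc₁, Int.mul_ediv_cancel' this]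
    have ha₂' : a₂ = -a' := by
      rw [ha₂, Int.mul_ediv_cancel_left _ (by exact_mod_cast hp.ne_zero)]
    clear hc₁ ha₂
    subst ha₂'
    have hκ' : φ x ^ k = -(c : κ) := by
      simp only [map_add, map_pow, map_intCast] at hκ
      exact eq_neg_of_add_eq_zero_left hκ
    obtain ⟨u, hu⟩ : p ^ l ∣ k := hl ▸ pow_padicValNat_dvd
    have hxu : φ (x ^ u) = φ ((-c : ℤ) : S) := by
      apply pow_prime_pow_injective (p := p) l
      rw [map_pow, ← pow_mul, mul_comm, ← hu, hκ', map_intCast, intCast_pow_prime_pow]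
      push_cast
      rfl
    have hxk : x ^ k = -c + p * c₁ := by
      rw [hu, mul_comm, pow_mul, h.pow_eq_pow hxu hl1]
      have := congrArg (Int.cast : ℤ → S) hc₁'
      push_cast at this ⊢
      linear_combination -this
    have hrel : φ (-a' * x ^ n + c₁) = 0 := by
      apply h.of_natCast_mul
      rw [hxk] at hF
      push_cast at hF
      linear_combination hF
    simp only [map_add, map_mul, map_pow, map_intCast, map_neg] at hrel
    rcases hcase with ⟨h1, h2⟩ | h1
    · apply h2
      rw [← CharP.intCast_eq_zero_iff κ p]
      have h3 := (CharP.intCast_eq_zero_iff κ p (-a')).2 h1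
      push_cast at h3
      rwa [h3, zero_mul, zero_add] at hrel
    · apply h1
      refine Dvd.dvd.mul_left ?_ _
      rw [← CharP.intCast_eq_zero_iff κ p]
      push_cast
      have e : n * k₁ = k * n₁ := by
        have h1 : n₁ * n.gcd k = n := hn₁ ▸ Nat.div_mul_cancel (Nat.gcd_dvd_left n k)
        have h2 : k₁ * n.gcd k = k := hk₁ ▸ Nat.div_mul_cancel (Nat.gcd_dvd_right n k)
        calc n * k₁ = n₁ * n.gcd k * k₁ := by rw [h1]
          _ = k₁ * n.gcd k * n₁ := by ring
          _ = _ := by rw [h2]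
      rw [← eq_neg_of_add_eq_zero_left hrel, mul_pow, ← pow_mul, e, pow_mul, hκ']
      ring

/-- In κ, F is the p^j-th power of (x^s' + c)^m - a·x^s, so this factor vanishes at the residue of
x. Lifting to S makes the other polynomial vanish there too, against coprimality. -/
lemma IsSquareZeroThickening.false_of_condV (h : IsSquareZeroThickening p φ) {a c : ℤ}
    {m n k : ℕ} {x : S}
    (hF : (x ^ k + c) ^ m - a * x ^ n = 0)
    (hc : CondV a c m n k p) : False := by
  have hp : p.Prime := Fact.out
  obtain ⟨hpca, hpk, j, s, s', a₁, T, hk, hn, hss, ha₁, hT, hcop⟩ := hc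
  have ha₁' : (p : ℤ) * a₁ = a ^ p ^ j - a := by
    rw [ha₁, Int.mul_ediv_cancel' (dvd_pow_prime_pow_sub hp j a)]
  clear ha₁
  have ha₁'' : (p : S) * a₁ = a ^ p ^ j - a := by
    have := congrArg (Int.cast : ℤ → S) ha₁'
    push_cast at this
    exact this
  have hT' : (x ^ s' + c) ^ p ^ j = x ^ k + c + p * aeval x T := by
    have := congrArg (aeval x) hT
    simp only [map_mul, map_sub, map_sum, map_pow, aeval_X, eq_intCast, map_intCast,
      map_natCast] at this
    rw [this, add_pow, Finset.sum_range_succ, hk]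
    have : ∀ i, (x ^ s') ^ i * (c : S) ^ (p ^ j - i) * ((p ^ j).choose i : S) =
        (p ^ j).choose i * c ^ (p ^ j - i) * x ^ (s' * i) := fun i => by
      rw [pow_mul]; ring
    simp only [this]
    simp only [Nat.choose_self, Nat.sub_self, mul_comm (p ^ j) s']
    ring
  have hpκ : (p : κ) = 0 := CharP.cast_eq_zero κ p
  have hbase : φ ((x ^ s' + c) ^ m) = φ (a * x ^ s) := by
    apply pow_prime_pow_injective (p := p) j
    rw [← map_pow, ← map_pow, pow_right_comm, hT']
    have := congrArg φ hF
    simp only [map_sub, map_add, map_mul, map_pow, map_intCast, map_natCast, map_zero,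
      hpκ] at this ⊢
    rw [zero_mul, add_zero, mul_pow, intCast_pow_prime_pow, ← pow_mul, mul_comm s, ← hn]
    linear_combination this
  have hrel : φ (a₁ * x ^ n - m * aeval x T * (x ^ k + c) ^ (m - 1)) = 0 := by
    apply h.of_natCast_mul
    -- For j = 0 nothing is lifted: p·a₁ and p·T(x) are already 0 in S.
    rcases Nat.eq_zero_or_pos j with rfl | hj
    · simp only [pow_zero, pow_one, one_mul] at hk hT' ha₁''
      rw [← hk] at hT'
      linear_combination x ^ n * ha₁'' + m * (x ^ k + c) ^ (m - 1) * hT'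
    have hlift := h.pow_eq_pow hbase hj
    rw [pow_right_comm, hT', h.pow_add_ker _ (by simp), mul_pow, ← pow_mul, mul_comm s, ← hn] at hlift
    linear_combination hF - hlift + x ^ n * ha₁''
  obtain ⟨u, v, huv⟩ := hcop
  have heval (f : ℤ[X]) : eval₂ (ZMod.castHom dvd_rfl κ) (φ x)
      (f.map (Int.castRingHom (ZMod p))) = φ (aeval x f) := by
    rw [eval₂_map, aeval_def, hom_eval₂]
    congr 1
    exact RingHom.ext_int _ _
  have := congrArg (eval₂ (ZMod.castHom dvd_rfl κ) (φ x)) huv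
  rw [eval₂_add, eval₂_mul, eval₂_mul, heval, heval, eval₂_one] at this
  have h1 : φ (aeval x (C a₁ * X ^ n - C (m : ℤ) * T * (X ^ k + C c) ^ (m - 1))) = 0 := by
    simpa using hrel
  have h2 : φ (aeval x ((X ^ s' + C c) ^ m - C a * X ^ s)) = 0 := by
    rw [← sub_eq_zero, ← map_sub] at hbase
    simpa using hbase
  rw [h1, h2] at this
  simp at this

lemma IsSquareZeroThickening.false_of_condVI (h : IsSquareZeroThickening p φ) {a c : ℤ}
    {m n k : ℕ} (hn : 1 ≤ n) (hkm : n < k * m) {x : S}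
    (hF : (x ^ k + c) ^ m - a * x ^ n = 0)
    (hc : CondVI a c m n k p) : False := by
  have hp : p.Prime := Fact.out
  obtain ⟨hpcak, ⟨m', rfl⟩, ⟨n', rfl⟩, hpa⟩ := hc
  have hk : k ≠ 0 := by rintro rfl; simp at hkm
  have hcκ : (c : κ) ≠ 0 := fun h0 =>
    hpcak ((((CharP.intCast_eq_zero_iff κ p c).1 h0).mul_right _).mul_right _)
  have hx : φ x ≠ 0 := by
    intro h0
    have := congrArg φ hF
    simp only [map_sub, map_add, map_mul φ, map_pow, h0, map_intCast, map_zero, zero_pow hk,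
      zero_pow (by omega : p * n' ≠ 0), mul_zero, sub_zero, zero_add] at this
    exact pow_ne_zero _ hcκ this
  have hκ : φ ((x ^ k + c) ^ m') = φ (a * x ^ n') := by
    apply pow_prime_pow_injective (p := p) 1
    have := congrArg φ hF
    rw [← map_pow, ← map_pow, pow_one, ← pow_mul, mul_comm m', mul_pow, ← pow_mul, mul_comm n',
      map_mul, map_pow φ (a : S), map_intCast]
    have h1 := intCast_pow_prime_pow κ p 1 a
    rw [pow_one] at h1
    rw [h1, ← sub_eq_zero]
    simpa using this
  have hlift := h.pow_eq_pow hκ le_rfl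
  rw [pow_one, ← pow_mul, mul_comm m', mul_pow, ← pow_mul, mul_comm n'] at hlift
  have hd := dvd_pow_prime_pow_sub hp 1 a
  rw [pow_one] at hd
  obtain ⟨b, hb⟩ := hd
  apply hpa
  rw [hb, sq]
  apply mul_dvd_mul_left
  have : φ (b * x ^ (p * n')) = 0 := by
    apply h.of_natCast_mul
    have := congrArg (Int.cast : ℤ → S) hb
    push_cast at this
    linear_combination hF - hlift - x ^ (p * n') * this
  rw [← CharP.intCast_eq_zero_iff κ p]
  simpa [hx] using this

/-- F = F' = 0 forces D·x^k = n·c in κ with D = km - n. Writing D·x^k = n·c + w in S and raising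
F(x) = 0 to the power k₁ eliminates x in favour of w. The coefficient of w has residue 0, so the
w-terms cancel and leave c^n₁·(𝒞 - ℰ) = 0 in S. -/
lemma IsSquareZeroThickening.false_of_condVII (h : IsSquareZeroThickening p φ) {a c : ℤ}
    {m n k : ℕ} (hn : 1 ≤ n) (hkm : n < k * m) {x : S}
    (hF : (x ^ k + c) ^ m - a * x ^ n = 0)
    (hF' : (k * m * φ x ^ (k - 1) * (φ x ^ k + c) ^ (m - 1) - n * a * φ x ^ (n - 1) : κ) = 0)
    (hc : CondVII a c m n k p) : False := by
  have hp : p.Prime := Fact.out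
  obtain ⟨hpcakm, n₁, k₁, hn₁, hk₁, hnd⟩ := hc
  have hk : k ≠ 0 := by rintro rfl; simp at hkm
  have hm : m ≠ 0 := by rintro rfl; simp at hkm
  have hne := mt (CharP.intCast_eq_zero_iff κ p _).1 hpcakm
  rw [Int.cast_mul, Int.cast_mul, Int.cast_mul, Int.cast_natCast, Int.cast_natCast] at hne
  have hmκ := right_ne_zero_of_mul hne
  have hkκ := right_ne_zero_of_mul (left_ne_zero_of_mul hne)
  have haκ := right_ne_zero_of_mul (left_ne_zero_of_mul (left_ne_zero_of_mul hne))
  have hcκ := left_ne_zero_of_mul (left_ne_zero_of_mul (left_ne_zero_of_mul hne))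
  have hFκ : (φ x ^ k + c) ^ m = a * φ x ^ n := by
    have := congrArg φ hF
    simpa [sub_eq_zero] using this
  have hx : φ x ≠ 0 := by
    intro h0
    rw [h0, zero_pow hk, zero_add, zero_pow (by omega : n ≠ 0), mul_zero] at hFκ
    exact pow_ne_zero _ hcκ hFκ
  have hax : (a * φ x ^ n : κ) ≠ 0 := mul_ne_zero haκ (pow_ne_zero n hx)
  have hcrit : (k * m * φ x ^ k : κ) = n * (φ x ^ k + c) := by
    apply mul_right_cancel₀ hax
    have e1 : φ x ^ k = φ x * φ x ^ (k - 1) := by rw [← pow_succ', Nat.sub_add_cancel (by omega)]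
    have e2 : φ x ^ n = φ x * φ x ^ (n - 1) := by rw [← pow_succ', Nat.sub_add_cancel (by omega)]
    have e3 : (φ x ^ k + c) ^ m = (φ x ^ k + c) * (φ x ^ k + c) ^ (m - 1) := by
      rw [← pow_succ', Nat.sub_add_cancel (by omega)]
    linear_combination φ x * (φ x ^ k + c) * hF' - k * m * φ x ^ k * hFκ
      + k * m * (φ x ^ k + c) ^ m * e1 + k * m * φ x * φ x ^ (k - 1) * e3
      - n * (φ x ^ k + c) * a * e2
  have hnκ : (n : κ) ≠ 0 := by
    intro h0
    rw [h0, zero_mul] at hcrit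
    simp [hkκ, hmκ, hx] at hcrit
  have hgn : n₁ * n.gcd k = n := hn₁ ▸ Nat.div_mul_cancel (Nat.gcd_dvd_left n k)
  have hgk : k₁ * n.gcd k = k := hk₁ ▸ Nat.div_mul_cancel (Nat.gcd_dvd_right n k)
  have hk₁n : k₁ * n = n₁ * k := by
    calc k₁ * n = k₁ * (n₁ * n.gcd k) := by rw [hgn]
      _ = n₁ * (k₁ * n.gcd k) := by ring
      _ = _ := by rw [hgk]
  have hn₁k₁ : n₁ < k₁ * m := by
    apply lt_of_mul_lt_mul_right (a := n.gcd k) _ (Nat.zero_le _)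
    calc n₁ * n.gcd k = n := hgn
      _ < k * m := hkm
      _ = k₁ * n.gcd k * m := by rw [hgk]
      _ = k₁ * m * n.gcd k := by ring
  set D : ℤ := (k : ℤ) * m - n with hD
  set w : S := D * x ^ k - n * c with hw
  have hDS : (D : S) = k * m - n := by rw [hD]; push_cast; rfl
  have hφw : φ w = 0 := by
    simp only [hw, hD, map_sub, map_mul, map_pow, map_intCast, map_natCast, Int.cast_sub,
      Int.cast_mul, Int.cast_natCast]
    linear_combination hcrit
  have hrel : (k * m * c : S) ^ (k₁ * m) + (k₁ * m : ℕ) * (k * m * c : S) ^ (k₁ * m - 1) * w =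
      a ^ k₁ * D ^ (k₁ * m - n₁) *
        ((n * c : S) ^ n₁ + n₁ * (n * c : S) ^ (n₁ - 1) * w) := by
    rw [← h.pow_add_ker _ hφw, ← h.pow_add_ker _ hφw]
    have e1 : (k * m * c + w : S) = D * (x ^ k + c) := by rw [hw, hDS]; ring
    have e2 : (n * c + w : S) = D * x ^ k := by rw [hw]; ring
    rw [e1, e2, mul_pow, mul_comm k₁ m, pow_mul (x ^ k + (c : S)), sub_eq_zero.1 hF, mul_pow,
      mul_pow, ← pow_mul, ← pow_mul, mul_comm n, hk₁n, mul_comm k n₁]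
    have e3 : (D : S) ^ (m * k₁) = D ^ (m * k₁ - n₁) * D ^ n₁ := by
      rw [← pow_add, Nat.sub_add_cancel (by rw [mul_comm]; exact hn₁k₁.le)]
    rw [e3]
    ring
  have hrelκ : (k * m * c : κ) ^ (k₁ * m) = a ^ k₁ * D ^ (k₁ * m - n₁) * (n * c : κ) ^ n₁ := by
    have := congrArg φ hrel
    simpa [hφw] using this
  have hn₁0 : n₁ ≠ 0 := by rintro rfl; simp at hgn; omega
  have hcoef : φ ((k₁ * m : ℕ) * (k * m * c : S) ^ (k₁ * m - 1) -
      a ^ k₁ * D ^ (k₁ * m - n₁) * (n₁ * (n * c : S) ^ (n₁ - 1))) = 0 := by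
    simp only [map_sub, map_mul, map_pow, map_intCast, map_natCast]
    apply eq_zero_of_ne_zero_of_mul_left_eq_zero
      (mul_ne_zero (mul_ne_zero hnκ hcκ) (mul_ne_zero hkκ hmκ))
    have e1 : (k * m * c : κ) ^ (k₁ * m) = (k * m * c) * (k * m * c) ^ (k₁ * m - 1) := by
      rw [← pow_succ', Nat.sub_add_cancel (by omega)]
    have e2 : (n * c : κ) ^ n₁ = (n * c) * (n * c) ^ (n₁ - 1) := by
      rw [← pow_succ', Nat.sub_add_cancel (by omega)]
    have e3 : (k₁ * n : κ) = n₁ * k := by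
      rw [← Nat.cast_mul, ← Nat.cast_mul, hk₁n]
    -- After multiplication by nc·km, both terms become multiples of the two sides of `hrelκ`, and
    -- k₁n = n₁k matches the factors.
    push_cast
    linear_combination -(n * k₁ * m : κ) * e1 + n₁ * k * m * hrelκ +
      a ^ k₁ * D ^ (k₁ * m - n₁) * n₁ * k * m * e2 + m * (k * m * c : κ) ^ (k₁ * m) * e3
  have hz := h.mul_of_ker _ _ hcoef hφw
  set E : ℤ := ((k : ℤ) * m) ^ (k₁ * m) * c ^ (k₁ * m - n₁)
        - a ^ k₁ * (n : ℤ) ^ n₁ * D ^ (k₁ * m - n₁) with hE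
  have hS : ((c ^ n₁ * E : ℤ) : S) = 0 := by
    have e4 : (c : S) ^ (k₁ * m) = c ^ (k₁ * m - n₁) * c ^ n₁ := by
      rw [← pow_add, Nat.sub_add_cancel hn₁k₁.le]
    rw [hE]
    push_cast
    rw [mul_pow _ (c : S), mul_pow _ (c : S), e4] at hrel
    linear_combination hrel - hz
  have hcp : IsCoprime (p : ℤ) (c ^ n₁) := by
    apply IsCoprime.pow_right
    rw [Prime.coprime_iff_not_dvd (Nat.prime_iff_prime_int.1 hp)]
    exact fun h0 => hcκ ((CharP.intCast_eq_zero_iff κ p c).2 h0)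
  apply hnd
  apply (hcp.pow_left (m := 2)).dvd_of_dvd_mul_left
  have hdvd : (p : ℤ) ∣ c ^ n₁ * E := by
    rw [← CharP.intCast_eq_zero_iff κ p, ← map_intCast φ, hS, map_zero]
  obtain ⟨e, he⟩ := hdvd
  rw [he] at hS ⊢
  rw [sq]
  exact mul_dvd_mul_left _ (h.natCast_mul_intCast hS)

theorem IsSquareZeroThickening.not_satisfiesCond (h : IsSquareZeroThickening p φ) {a c : ℤ}
    {m n k : ℕ} (hn : 1 ≤ n) (hkm : n < k * m) {x : S}
    (hF : (x ^ k + c) ^ m - a * x ^ n = 0)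
    (hF' : (k * m * φ x ^ (k - 1) * (φ x ^ k + c) ^ (m - 1) - n * a * φ x ^ (n - 1) : κ) = 0) :
    ¬ SatisfiesCond a c m n k p := by
  rintro (hc | hc | hc | hc | hc | hc | hc)
  · exact h.false_of_condI hn hkm hF hc
  · exact h.false_of_condII hkm hF hF' hc
  · exact h.false_of_condIII hkm hF hF' hc
  · exact h.false_of_condIV hkm hF hc
  · exact h.false_of_condV hF hc
  · exact h.false_of_condVI hn hkm hF hc
  · exact h.false_of_condVII hn hkm hF hF' hc

end Cases

/-! ### Ideals of ℤ[X] containing a prime, and their squares. -/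

lemma Polynomial.C_natCast_dvd_iff_map_eq_zero {p : ℕ} (f : ℤ[X]) :
    C (p : ℤ) ∣ f ↔ f.map (Int.castRingHom (ZMod p)) = 0 := by
  rw [C_dvd_iff_dvd_coeff, Polynomial.ext_iff]
  simp [ZMod.intCast_zmod_eq_zero_iff_dvd]

/-- Modulo p the ideal is principal; g lifts a generator, and a monic element of I keeps it nonzero.
-/
lemma exists_span_pair_eq_of_C_mem {p : ℕ} [Fact p.Prime] {I : Ideal ℤ[X]}
    (hp : C (p : ℤ) ∈ I) {F : ℤ[X]} (hF : F ∈ I) (hFm : F.Monic) :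
    ∃ g : ℤ[X], I = Ideal.span {C (p : ℤ), g} ∧ g.map (Int.castRingHom (ZMod p)) ≠ 0 := by
  let ψ := mapRingHom (Int.castRingHom (ZMod p))
  have hψ : Function.Surjective ψ := map_surjective _ (ZMod.intCast_surjective)
  obtain ⟨g, hgI, hg⟩ := (Ideal.mem_map_iff_of_surjective ψ hψ).1
    (Submodule.IsPrincipal.generator_mem (I.map ψ))
  have hdvd : ∀ f ∈ I, ψ g ∣ ψ f := fun f hf => by
    rw [hg, ← Submodule.IsPrincipal.mem_iff_generator_dvd]
    exact Ideal.mem_map_of_mem ψ hf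
  refine ⟨g, le_antisymm (fun f hf => ?_) ?_, fun h0 => ?_⟩
  · obtain ⟨q', hq⟩ := hdvd f hf
    obtain ⟨q, rfl⟩ := hψ q'
    have : C (p : ℤ) ∣ f - g * q := by
      rw [C_natCast_dvd_iff_map_eq_zero]
      change ψ (f - g * q) = 0
      rw [map_sub, map_mul, hq, sub_self]
    obtain ⟨r, hr⟩ := this
    exact Ideal.mem_span_pair.2 ⟨r, q, by linear_combination -hr⟩
  · rw [Ideal.span_le]
    rintro f (rfl | rfl)
    · exact hp
    · exact hgI
  · have := hdvd F hF
    rw [show ψ g = 0 from h0, zero_dvd_iff] at this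
    exact (hFm.map (Int.castRingHom (ZMod p))).ne_zero this

/-- With I = (p, g), elements of I² have the form p·u + g²·v with u ∈ I. If p divides such an
element, then p divides v, because g ≠ 0 modulo p; cancelling p stays in I. -/
lemma mem_of_C_mul_mem_sq {p : ℕ} [Fact p.Prime] {I : Ideal ℤ[X]}
    (hp : C (p : ℤ) ∈ I) {F : ℤ[X]} (hF : F ∈ I) (hFm : F.Monic) {f : ℤ[X]}
    (hf : C (p : ℤ) * f ∈ I ^ 2) : f ∈ I := by
  obtain ⟨g, hI, hg⟩ := exists_span_pair_eq_of_C_mem hp hF hFm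
  have hgI : g ∈ I := hI ▸ Ideal.subset_span (by simp)
  have key : ∀ h ∈ I ^ 2, ∃ u ∈ I, ∃ v, h = C (p : ℤ) * u + g ^ 2 * v := by
    intro h hh
    rw [sq] at hh
    refine Submodule.mul_induction_on hh ?_ ?_
    · intro r hr s hs
      have hs' := hs
      rw [hI, Ideal.mem_span_pair] at hr hs'
      obtain ⟨r₁, r₂, rfl⟩ := hr
      obtain ⟨s₁, s₂, rfl⟩ := hs'
      refine ⟨r₁ * (s₁ * C (p : ℤ) + s₂ * g) + r₂ * g * s₁, ?_, r₂ * s₂, by ring⟩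
      exact I.add_mem (I.mul_mem_left _ hs) (I.mul_mem_right _ (I.mul_mem_left _ hgI))
    · rintro _ _ ⟨u, hu, v, rfl⟩ ⟨u', hu', v', rfl⟩
      exact ⟨u + u', I.add_mem hu hu', v + v', by ring⟩
  obtain ⟨u, hu, v, huv⟩ := key _ hf
  have hv : C (p : ℤ) ∣ v := by
    have h0 : C (p : ℤ) ∣ g ^ 2 * v := ⟨f - u, by linear_combination -huv⟩
    rw [C_natCast_dvd_iff_map_eq_zero] at h0 ⊢
    rw [Polynomial.map_mul, Polynomial.map_pow] at h0
    exact (mul_eq_zero.1 h0).resolve_left (pow_ne_zero 2 hg)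
  obtain ⟨v', rfl⟩ := hv
  have hpne : C (p : ℤ) ≠ 0 := by
    simpa using (Fact.out : p.Prime).ne_zero
  have : f = u + g * (g * v') := by
    apply mul_left_cancel₀ hpne
    linear_combination huv
  rw [this]
  exact I.add_mem hu (I.mul_mem_right _ hgI)

lemma Polynomial.derivative_mem_of_mem_sq {R : Type*} [CommRing R] {I : Ideal R[X]} {f : R[X]}
    (hf : f ∈ I ^ 2) : derivative f ∈ I := by
  rw [sq] at hf
  refine Submodule.mul_induction_on hf ?_ ?_
  · intro r hr s hs
    rw [derivative_mul]
    exact I.add_mem (I.mul_mem_left _ hs) (I.mul_mem_right _ hr)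
  · intro x y hx hy
    rw [derivative_add]
    exact I.add_mem hx hy

/-- Up to sign the discriminant is the resultant of f and f', a polynomial combination of the two.
-/
lemma Polynomial.Monic.C_discr_mem {R : Type*} [CommRing R] {I : Ideal R[X]} {f : R[X]}
    (hm : f.Monic) (hd : 0 < f.natDegree) (hf : f ∈ I) (hf' : derivative f ∈ I) :
    C f.discr ∈ I := by
  obtain ⟨u, v, -, -, h⟩ := exists_mul_add_mul_eq_C_resultant f (derivative f) le_rfl
    (natDegree_derivative_le f) (Or.inl hd.ne')
  rw [resultant_deriv (natDegree_pos_iff_degree_pos.1 hd), hm.leadingCoeff, mul_one] at h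
  have h1 : C ((-1) ^ (f.natDegree * (f.natDegree - 1) / 2) * f.discr) ∈ I :=
    h ▸ I.add_mem (I.mul_mem_right _ hf) (I.mul_mem_right _ hf')
  have h2 := I.mul_mem_left (C ((-1) ^ (f.natDegree * (f.natDegree - 1) / 2))) h1
  rwa [← C_mul, ← mul_assoc, ← mul_pow, neg_one_mul, neg_neg, one_pow, one_mul] at h2

lemma isSquareZeroThickening_factor {p : ℕ} [Fact p.Prime] {I : Ideal ℤ[X]} [hI : I.IsMaximal]
    (hp : C (p : ℤ) ∈ I) {F : ℤ[X]} (hF : F ∈ I) (hFm : F.Monic) :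
    let _ := Ideal.Quotient.field I
    IsSquareZeroThickening p (Ideal.Quotient.factor (Ideal.pow_le_self (I := I) two_ne_zero)) := by
  let _ := Ideal.Quotient.field I
  constructor
  · intro u v hu hv
    obtain ⟨u, rfl⟩ := Ideal.Quotient.mk_surjective u
    obtain ⟨v, rfl⟩ := Ideal.Quotient.mk_surjective v
    rw [Ideal.Quotient.factor_mk, Ideal.Quotient.eq_zero_iff_mem] at hu hv
    rw [← map_mul, Ideal.Quotient.eq_zero_iff_mem, sq]
    exact Ideal.mul_mem_mul hu hv
  · intro s hs
    obtain ⟨s, rfl⟩ := Ideal.Quotient.mk_surjective s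
    rw [Ideal.Quotient.factor_mk, Ideal.Quotient.eq_zero_iff_mem]
    apply mem_of_C_mul_mem_sq hp hF hFm
    rw [← Ideal.Quotient.eq_zero_iff_mem, map_mul, ← hs]
    simp

/-! ### F avoids the squares of maximal ideals. -/

section auxPoly

variable (a c : ℤ) {m n k : ℕ}

lemma auxPoly_monic_natDegree (hkm : n < k * m) :
    (auxPoly a c m n k).Monic ∧ (auxPoly a c m n k).natDegree = k * m := by
  have hk : k ≠ 0 := by rintro rfl; simp at hkm
  have h1 : ((X ^ k + C c : ℤ[X]) ^ m).Monic := (monic_X_pow_add_C c hk).pow m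
  have h2 : ((X ^ k + C c : ℤ[X]) ^ m).natDegree = k * m := by
    rw [natDegree_pow, natDegree_X_pow_add_C, mul_comm]
  have h3 : (C a * X ^ n : ℤ[X]).natDegree < ((X ^ k + C c : ℤ[X]) ^ m).natDegree :=
    h2 ▸ (natDegree_C_mul_X_pow_le a n).trans_lt hkm
  refine ⟨h1.sub_of_left (degree_lt_degree h3), ?_⟩
  rw [auxPoly, natDegree_sub_eq_left_of_natDegree_lt h3, h2]

theorem auxPoly_notMem_sq (hn : 1 ≤ n) (hkm : n < k * m)
    (hcond : ∀ p : ℕ, p.Prime → (p : ℤ) ∣ (auxPoly a c m n k).discr →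
      SatisfiesCond a c m n k p) {p : ℕ} (hp : p.Prime) {I : Ideal ℤ[X]} [I.IsMaximal]
    (hpI : C (p : ℤ) ∈ I) : auxPoly a c m n k ∉ I ^ 2 := by
  intro hF2
  have := Fact.mk hp
  let _ := Ideal.Quotient.field I
  obtain ⟨hm, hd⟩ := auxPoly_monic_natDegree a c hkm
  have hF : auxPoly a c m n k ∈ I := Ideal.pow_le_self two_ne_zero hF2
  have hF' := derivative_mem_of_mem_sq hF2
  have hp0 : (p : ℤ[X] ⧸ I) = 0 := by
    rw [← Ideal.Quotient.eq_zero_iff_mem] at hpI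
    simpa using hpI
  have : CharP (ℤ[X] ⧸ I) p := (CharP.charP_iff_prime_eq_zero hp).2 hp0
  have hdisc := hm.C_discr_mem (by omega) hF hF'
  have hpd : (p : ℤ) ∣ (auxPoly a c m n k).discr := by
    rw [← CharP.intCast_eq_zero_iff (ℤ[X] ⧸ I) p]
    rw [← Ideal.Quotient.eq_zero_iff_mem] at hdisc
    simpa using hdisc
  refine (isSquareZeroThickening_factor hpI hF hm).not_satisfiesCond hn hkm
    (x := Ideal.Quotient.mk (I ^ 2) X) ?_ ?_ (hcond p hp hpd)
  · rw [← Ideal.Quotient.eq_zero_iff_mem] at hF2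
    simpa [auxPoly] using hF2
  · rw [← Ideal.Quotient.eq_zero_iff_mem] at hF'
    simp only [auxPoly, derivative_sub, derivative_C_mul, derivative_pow,
      derivative_X, mul_one,
      derivative_add, derivative_C, add_zero] at hF'
    simp only [map_sub, map_mul, map_add, map_pow, eq_intCast, map_intCast, map_natCast] at hF'
    rw [Ideal.Quotient.factor_mk]
    linear_combination hF'

end auxPoly

/-! ### Integral closedness of ℤ[θ]. -/

lemma isPrincipal_maximalIdeal_of_relation {A : Type*} [CommRing A] {P : Ideal A} [P.IsMaximal]
    {a b u v : A} (hP : P = Ideal.span {a, b}) (hu : u ∉ P) (h : u * a + v * b = 0) :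
    (IsLocalRing.maximalIdeal (Localization.AtPrime P)).IsPrincipal := by
  set f := algebraMap A (Localization.AtPrime P)
  have hunit : IsUnit (f u) :=
    IsLocalization.map_units (Localization.AtPrime P) (⟨u, hu⟩ : P.primeCompl)
  refine ⟨f b, ?_⟩
  rw [← Localization.AtPrime.map_eq_maximalIdeal]
  have hmap : P.map f = Ideal.span {f a, f b} := by
    rw [congrArg (Ideal.map f) hP, Ideal.map_span, Set.image_pair]
  refine hmap.trans ?_
  obtain ⟨w, hw⟩ := hunit.exists_left_inv
  refine le_antisymm (Ideal.span_le.2 ?_) (Ideal.span_mono (by simp))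
  rintro x (rfl | rfl)
  · refine Ideal.mem_span_singleton.2 ⟨-w * f v, ?_⟩
    have := congrArg f h
    rw [map_add, map_mul, map_mul, map_zero] at this
    linear_combination -f a * hw + w * this
  · exact Ideal.mem_span_singleton_self _

/-- Write F = u·a + v·b. If u and v both mapped into P, F would lie in the square; so one becomes a
unit in the localization, and its generator is a multiple of the other. A Noetherian local domain
with principal maximal ideal is integrally closed. -/
lemma isIntegrallyClosed_localization_of_notMem_sq {R A : Type*} [CommRing R] [CommRing A]
    [IsDomain A] [IsNoetherianRing A] {π : R →+* A} (hπ : Function.Surjective π) {P : Ideal A}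
    [P.IsMaximal] {a b F : R} (hP : P.comap π = Ideal.span {a, b}) (hF : π F = 0)
    (hF2 : F ∉ P.comap π ^ 2) : IsIntegrallyClosed (Localization.AtPrime P) := by
  suffices h : (IsLocalRing.maximalIdeal (Localization.AtPrime P)).IsPrincipal by
    have htfae := tfae_of_isNoetherianRing_of_isLocalRing_of_isDomain (Localization.AtPrime P)
    exact ((htfae.out 4 3 rfl rfl).1 h).1
  have hPspan : P = Ideal.span {π a, π b} := by
    rw [← Ideal.map_comap_of_surjective π hπ P, hP, Ideal.map_span, Set.image_pair]
  have hFI : F ∈ P.comap π := by rw [Ideal.mem_comap, hF]; exact P.zero_mem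
  have haI : a ∈ P.comap π := hP ▸ Ideal.subset_span (by simp)
  have hbI : b ∈ P.comap π := hP ▸ Ideal.subset_span (by simp)
  rw [hP, Ideal.mem_span_pair] at hFI
  obtain ⟨u, v, rfl⟩ := hFI
  rw [map_add, map_mul, map_mul] at hF
  by_cases hu : π u ∈ P
  · by_cases hv : π v ∈ P
    · refine (hF2 ?_).elim
      rw [sq]
      exact Ideal.add_mem _ (Ideal.mul_mem_mul hu haI) (Ideal.mul_mem_mul hv hbI)
    · rw [Set.pair_comm] at hPspan
      exact isPrincipal_maximalIdeal_of_relation hPspan hv (by rw [add_comm]; exact hF)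
  · exact isPrincipal_maximalIdeal_of_relation hPspan hu hF

lemma Ideal.IsMaximal.exists_prime_mem {I : Ideal ℤ} (hI : I.IsMaximal) :
    ∃ p : ℕ, p.Prime ∧ (p : ℤ) ∈ I := by
  have hne : I ≠ ⊥ := Ring.ne_bot_of_isMaximal_of_not_isField hI Int.not_isField
  have := hI.isPrime
  have hprime := Submodule.IsPrincipal.prime_generator_of_isPrime I hne
  exact ⟨_, Int.prime_iff_natAbs_prime.1 hprime,
    I.mem_of_dvd (Int.dvd_natAbs.2 dvd_rfl) (Submodule.IsPrincipal.generator_mem I)⟩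

/-- The ring `ℤ[θ]` generated by a root of a monic `F` is integrally closed as soon as `F` does
not lie in the square of a maximal ideal of `ℤ[X]`. -/
theorem isIntegrallyClosed_adjoin_of_notMem_sq {K : Type*} [Field K] [CharZero K] {θ : K} {F : ℤ[X]}
    (hFm : F.Monic) (hθ : aeval θ F = 0)
    (hF : ∀ p : ℕ, p.Prime → ∀ I : Ideal ℤ[X], I.IsMaximal → C (p : ℤ) ∈ I → F ∉ I ^ 2) :
    IsIntegrallyClosed (aeval (R := ℤ) θ).range := by
  set A := (aeval (R := ℤ) θ).range
  let π : ℤ[X] →ₐ[ℤ] A := (aeval (R := ℤ) θ).rangeRestrict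
  have hπ : Function.Surjective π := (aeval (R := ℤ) θ).rangeRestrict_surjective
  have : IsNoetherianRing A := isNoetherianRing_of_surjective _ _ π.toRingHom hπ
  have hint : Algebra.IsIntegral ℤ A := by
    have hθi : IsIntegral ℤ θ := ⟨F, hFm, hθ⟩
    have := Algebra.IsIntegral.adjoin (R := ℤ) (S := ({θ} : Set K)) (by simpa using hθi)
    rwa [Algebra.adjoin_singleton_eq_range_aeval] at this
  have hπF : π F = 0 := Subtype.ext hθ
  refine IsIntegrallyClosed.of_localization_maximal fun P _ hP => ?_
  obtain ⟨p, hp, hpP⟩ :=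
    (Ideal.isMaximal_comap_of_isIntegral_of_isMaximal (R := ℤ) P).exists_prime_mem
  have := Fact.mk hp
  have hI : (P.comap π.toRingHom).IsMaximal := Ideal.comap_isMaximal_of_surjective _ hπ
  have hpI : C (p : ℤ) ∈ P.comap π.toRingHom := by
    rw [Ideal.mem_comap] at hpP ⊢
    simpa using hpP
  have hFI : F ∈ P.comap π.toRingHom := by
    rw [Ideal.mem_comap]
    exact hπF ▸ P.zero_mem
  obtain ⟨g, hg, -⟩ := exists_span_pair_eq_of_C_mem hpI hFI hFm
  exact isIntegrallyClosed_localization_of_notMem_sq hπ hg hπF (hF p hp _ hI hpI)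

lemma exists_ne_zero_mul_aeval_mem_range {K : Type*} [Field K] [CharZero K] (θ : K) (r : ℚ[X]) :
    ∃ N : ℤ, N ≠ 0 ∧ N * aeval θ r ∈ (aeval (R := ℤ) θ).range := by
  obtain ⟨b, hbM, hb⟩ := IsLocalization.integerNormalization_spec (nonZeroDivisors ℤ) r
  refine ⟨b, nonZeroDivisors.ne_zero hbM,
    IsLocalization.integerNormalization (nonZeroDivisors ℤ) r, ?_⟩
  have := congrArg (aeval θ) hb
  rw [aeval_map_algebraMap] at this
  simpa [Algebra.smul_def] using this

/-- Integral elements of `ℚ(θ)` lie in `ℤ[θ]` when that ring is integrally closed. -/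
theorem mem_range_aeval_of_isIntegral {K : Type*} [Field K] [CharZero K] {θ β : K}
    (hA : IsIntegrallyClosed (aeval (R := ℤ) θ).range)
    (hβ : β ∈ IntermediateField.adjoin ℚ ({θ} : Set K)) (hint : IsIntegral ℤ β) :
    β ∈ (aeval (R := ℤ) θ).range := by
  obtain ⟨r, s, rfl⟩ := (IntermediateField.mem_adjoin_simple_iff ℚ β).1 hβ
  by_cases hs : aeval θ s = 0
  · rw [hs, div_zero]; exact Subalgebra.zero_mem _
  obtain ⟨M, hM, hr⟩ := exists_ne_zero_mul_aeval_mem_range θ r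
  obtain ⟨N, hN, hs'⟩ := exists_ne_zero_mul_aeval_mem_range θ s
  set A := (aeval (R := ℤ) θ).range
  have hMK : (M : K) ≠ 0 := Int.cast_ne_zero.2 hM
  have hNK : (N : K) ≠ 0 := Int.cast_ne_zero.2 hN
  let ψ : FractionRing A →ₐ[A] K :=
    IsFractionRing.liftAlgHom (g := Algebra.ofId A K) Subtype.val_injective
  -- Cross-multiplying the two denominators puts the same factor M·N on numerator and denominator.
  let b : A := N * ⟨_, hr⟩
  let d : A := M * ⟨_, hs'⟩
  have hz : ψ (algebraMap A _ b / algebraMap A _ d) = aeval θ r / aeval θ s := by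
    rw [map_div₀, AlgHom.commutes, AlgHom.commutes]
    change ((N : A) : K) * _ / (((M : A) : K) * _) = _
    rw [SubringClass.coe_intCast, SubringClass.coe_intCast]
    field_simp
  rw [← hz] at hint ⊢
  have h1 : IsIntegral A (algebraMap A (FractionRing A) b / algebraMap A (FractionRing A) d) :=
    (isIntegral_algHom_iff ψ ψ.toRingHom.injective).1 hint.tower_top
  obtain ⟨y, hy⟩ := IsIntegrallyClosed.isIntegral_iff.1 h1
  rw [← hy, AlgHom.commutes]
  exact y.2

/-! ### Linear differential equations with distinct characteristic roots. -/

section ODE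

variable {𝕜 : Type*} [RCLike 𝕜]

/-- The constant coefficient differential operator `q(d/dx)` applied to `y`. -/
noncomputable def diffPoly (q : 𝕜[X]) (y : ℝ → 𝕜) (x : ℝ) : 𝕜 :=
  q.sum fun i b => b * iteratedDeriv i y x

lemma diffPoly_add (q r : 𝕜[X]) (y : ℝ → 𝕜) (x : ℝ) :
    diffPoly (q + r) y x = diffPoly q y x + diffPoly r y x :=
  sum_add_index _ _ _ (by simp) (by intros; ring)

lemma diffPoly_C_mul (b : 𝕜) (q : 𝕜[X]) (y : ℝ → 𝕜) (x : ℝ) :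
    diffPoly (C b * q) y x = b * diffPoly q y x := by
  rw [diffPoly, ← smul_eq_C_mul, sum_smul_index _ _ _ (by simp), diffPoly, sum_def, sum_def,
    Finset.mul_sum]
  simp only [mul_assoc]

lemma diffPoly_sub (q r : 𝕜[X]) (y : ℝ → 𝕜) (x : ℝ) :
    diffPoly (q - r) y x = diffPoly q y x - diffPoly r y x := by
  rw [eq_sub_iff_add_eq, ← diffPoly_add, sub_add_cancel]

lemma diffPoly_finsetSum {ι : Type*} (s : Finset ι) (q : ι → 𝕜[X]) (y : ℝ → 𝕜) (x : ℝ) :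
    diffPoly (∑ i ∈ s, q i) y x = ∑ i ∈ s, diffPoly (q i) y x := by
  classical
  induction s using Finset.induction_on with
  | empty => simp [diffPoly]
  | insert i s hi ih => rw [Finset.sum_insert hi, Finset.sum_insert hi, diffPoly_add, ih]

lemma diffPoly_one (y : ℝ → 𝕜) : diffPoly 1 y = y := by
  ext x
  rw [diffPoly, ← C_1, sum_C_index (by simp)]
  simp

lemma diffPoly_X_pow (n : ℕ) (y : ℝ → 𝕜) (x : ℝ) : diffPoly (X ^ n) y x = iteratedDeriv n y x := by
  rw [diffPoly, ← monomial_one_right_eq_X_pow, sum_monomial_index _ _ (by simp), one_mul]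

lemma hasDerivAt_diffPoly {N : ℕ} {y : ℝ → 𝕜}
    (hy : ∀ i < N, Differentiable ℝ (iteratedDeriv i y)) {q : 𝕜[X]} (hq : q.natDegree < N) (x : ℝ) :
    HasDerivAt (diffPoly q y) (diffPoly (X * q) y x) x := by
  have h1 : diffPoly q y = fun x => ∑ i ∈ Finset.range N, q.coeff i * iteratedDeriv i y x := by
    ext x
    exact sum_over_range' q (by simp) N hq
  have h2 : diffPoly (X * q) y x =
      ∑ i ∈ Finset.range N, q.coeff i * iteratedDeriv (i + 1) y x := by
    rw [diffPoly, sum_over_range' (X * q) (by simp) (N + 1)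
      (lt_of_le_of_lt natDegree_mul_le (by rw [natDegree_X]; omega)), Finset.sum_range_succ']
    simp
  rw [h1, h2]
  refine HasDerivAt.fun_sum fun i hi => HasDerivAt.const_mul _ ?_
  rw [iteratedDeriv_succ]
  exact (hy i (Finset.mem_range.1 hi) x).hasDerivAt

lemma iteratedDeriv_diffPoly {N : ℕ} {y : ℝ → 𝕜}
    (hy : ∀ i < N, Differentiable ℝ (iteratedDeriv i y)) {q : 𝕜[X]} {j : ℕ}
    (hq : q.natDegree + j ≤ N) : iteratedDeriv j (diffPoly q y) = diffPoly (X ^ j * q) y := by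
  induction j with
  | zero => simp
  | succ j ih =>
    ext x
    rw [iteratedDeriv_succ, ih (by omega), pow_succ', mul_assoc]
    refine (hasDerivAt_diffPoly hy ?_ x).deriv
    refine lt_of_le_of_lt natDegree_mul_le ?_
    rw [natDegree_X_pow]
    omega

lemma diffOp_iterate_eq_diffPoly {N : ℕ} {y : ℝ → 𝕜}
    (hy : ∀ i < N, Differentiable ℝ (iteratedDeriv i y)) (k : ℕ) (c : ℤ) {m : ℕ} (hm : k * m ≤ N) :
    (diffOp k c)^[m] y = diffPoly ((X ^ k + C (c : 𝕜)) ^ m) y := by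
  induction m with
  | zero => simp [diffPoly_one]
  | succ m ih =>
    rw [mul_add, mul_one] at hm
    rw [Function.iterate_succ_apply', ih (by omega)]
    ext x
    rw [diffOp, iteratedDeriv_diffPoly hy, pow_succ', add_mul, diffPoly_add, diffPoly_C_mul]
    rw [natDegree_pow, natDegree_X_pow_add_C, mul_comm]
    exact hm

lemma isODESolution_iff_diffPoly {a c : ℤ} {m n k : ℕ} {y : ℝ → 𝕜} :
    IsODESolution a c m n k y ↔ (∀ i < k * m, Differentiable ℝ (iteratedDeriv i y)) ∧
      ∀ x, diffPoly ((auxPoly a c m n k).map (Int.castRingHom 𝕜)) y x = 0 := by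
  refine and_congr_right fun hy => forall_congr' fun x => ?_
  rw [diffOp_iterate_eq_diffPoly hy k c le_rfl]
  have hF : (auxPoly a c m n k).map (Int.castRingHom 𝕜) =
      (X ^ k + C (c : 𝕜)) ^ m - C (a : 𝕜) * X ^ n := by
    simp only [auxPoly, Polynomial.map_sub, Polynomial.map_mul, Polynomial.map_pow,
      Polynomial.map_add, map_X, map_C, Int.coe_castRingHom]
  rw [hF, diffPoly_sub, diffPoly_C_mul, diffPoly_X_pow]

/-- The product of any solution with `e (-r)` is constant; applying this to `e r` itself shows that
`e (-r)` is its inverse. Keeping `e` abstract serves the real and complex exponentials alike. -/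
lemma eq_mul_of_hasDerivAt_mul {e : 𝕜 → ℝ → 𝕜} (he : ∀ r x, HasDerivAt (e r) (r * e r x) x)
    (he0 : ∀ r, e r 0 = 1) {f : ℝ → 𝕜} {r : 𝕜} (hf : ∀ x, HasDerivAt f (r * f x) x) (x : ℝ) :
    f x = f 0 * e r x := by
  have key : ∀ g : ℝ → 𝕜, (∀ x, HasDerivAt g (r * g x) x) → ∀ x, g x * e (-r) x = g 0 := by
    intro g hg x
    have hd : ∀ x, HasDerivAt (fun x => g x * e (-r) x) 0 x := fun x => by
      have := (hg x).fun_mul (he (-r) x)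
      rwa [show r * g x * e (-r) x + g x * (-r * e (-r) x) = 0 by ring] at this
    have := is_const_of_deriv_eq_zero (fun x => (hd x).differentiableAt)
      (fun x => (hd x).deriv) x 0
    simpa [he0] using this
  have h1 := key f hf x
  have h2 := key (e r) (he r) x
  rw [he0] at h2
  linear_combination e r x * h1 - f x * h2

/-- If the characteristic polynomial has distinct roots `r i` then the solutions are the linear
combinations of the exponentials `e (r i)`. -/
theorem isODESolution_iff_exists_sum {e : 𝕜 → ℝ → 𝕜}
    (he : ∀ r x, HasDerivAt (e r) (r * e r x) x) (he0 : ∀ r, e r 0 = 1)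
    {a c : ℤ} {m n k : ℕ} (hkm : 0 < k * m) {r : Fin (k * m) → 𝕜} (hr : Function.Injective r)
    (hF : (auxPoly a c m n k).map (Int.castRingHom 𝕜) = ∏ i, (X - C (r i))) {y : ℝ → 𝕜} :
    IsODESolution a c m n k y ↔
      ∃ α : Fin (k * m) → 𝕜, ∀ x, y x = ∑ i, α i * e (r i) x := by
  rw [isODESolution_iff_diffPoly, hF]
  constructor
  · rintro ⟨hy, hsol⟩
    let B := fun i => Lagrange.basis Finset.univ r i
    have hB : ∀ i x, HasDerivAt (diffPoly (B i) y) (r i * diffPoly (B i) y x) x := by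
      intro i x
      have hdeg : (B i).natDegree < k * m := by
        rw [Lagrange.natDegree_basis hr.injOn (Finset.mem_univ i), Finset.card_univ,
          Fintype.card_fin]
        omega
      -- (X - r_i)·L_i is a constant multiple of F, which annihilates y; hence L_i(d/dx) y solves f'
      -- = r_i f.
      have hprod : ∃ w : 𝕜, X * B i = C (r i) * B i + C w * ∏ i, (X - C (r i)) := by
        refine ⟨Lagrange.nodalWeight Finset.univ r i, ?_⟩
        have h1 : B i = _ := Lagrange.basis_eq_prod_sub_inv_mul_nodal_div (v := r) (Finset.mem_univ i)
        rw [← Lagrange.nodal_erase_eq_nodal_div (Finset.mem_univ i)] at h1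
        rw [← Lagrange.nodal_eq, Lagrange.nodal_eq_mul_nodal_erase (Finset.mem_univ i), h1]
        ring
      obtain ⟨w, hw⟩ := hprod
      have := hasDerivAt_diffPoly hy hdeg x
      rwa [hw, diffPoly_add, diffPoly_C_mul, diffPoly_C_mul, hsol, mul_zero, add_zero] at this
    refine ⟨fun i => diffPoly (B i) y 0, fun x => ?_⟩
    have hne : (Finset.univ : Finset (Fin (k * m))).Nonempty := ⟨⟨0, hkm⟩, Finset.mem_univ _⟩
    calc y x = diffPoly 1 y x := by rw [diffPoly_one]
      _ = ∑ i, diffPoly (B i) y x := by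
        rw [← Lagrange.sum_basis hr.injOn hne, diffPoly_finsetSum]
      _ = _ := Finset.sum_congr rfl fun i _ => eq_mul_of_hasDerivAt_mul he he0 (hB i) x
  · rintro ⟨α, hα⟩
    have hsum : ∀ j x, HasDerivAt (fun x => ∑ i, α i * r i ^ j * e (r i) x)
        (∑ i, α i * r i ^ (j + 1) * e (r i) x) x := fun j x => by
      refine HasDerivAt.fun_sum fun i _ => ?_
      rw [pow_succ, ← mul_assoc, mul_assoc]
      exact (he (r i) x).const_mul _
    have hd : ∀ j, iteratedDeriv j y = fun x => ∑ i, α i * r i ^ j * e (r i) x := by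
      intro j
      induction j with
      | zero => ext x; simp [hα]
      | succ j ih => ext x; rw [iteratedDeriv_succ, ih, (hsum j x).deriv]
    refine ⟨fun j _ x => (hd j ▸ hsum j x).differentiableAt, fun x => ?_⟩
    -- Exponentials are eigenfunctions: q(d/dx) scales `e (r i)` by q(r_i), which is 0 for q = F.
    have heval : ∀ q : 𝕜[X], diffPoly q y x = ∑ i, α i * q.eval (r i) * e (r i) x := by
      intro q
      rw [diffPoly, sum_def]
      simp only [hd, eval_eq_sum, sum_def, Finset.mul_sum, Finset.sum_mul]
      rw [Finset.sum_comm]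
      refine Finset.sum_congr rfl fun i _ => Finset.sum_congr rfl fun j _ => by ring
    rw [heval]
    refine Finset.sum_eq_zero fun i _ => ?_
    rw [eval_prod, Finset.prod_eq_zero (Finset.mem_univ i) (by simp), mul_zero, zero_mul]

end ODE

/-- The roots of `auxPoly a c m n k` are integral polynomials in one root `θ` when the root field
of `θ` is the splitting field and the conditions at the primes dividing the discriminant hold. -/
theorem exists_int_coords_of_roots {a c : ℤ} {m n k : ℕ} (hn : 1 ≤ n) (hkm : n < k * m)
    (hirr : Irreducible ((auxPoly a c m n k).map (Int.castRingHom ℚ)))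
    {θ : ℂ} (hθ : aeval θ (auxPoly a c m n k) = 0)
    (hsplit : IsSplittingField ℚ (IntermediateField.adjoin ℚ ({θ} : Set ℂ))
      ((auxPoly a c m n k).map (Int.castRingHom ℚ)))
    (hcond : ∀ p : ℕ, p.Prime → (p : ℤ) ∣ (auxPoly a c m n k).discr →
      SatisfiesCond a c m n k p) :
    ∃ d : Fin (k * m) → Fin (k * m) → ℤ,
      Function.Injective (fun i => ∑ j, (d i j : ℂ) * θ ^ (j : ℕ)) ∧
      (auxPoly a c m n k).map (Int.castRingHom ℂ) =
        ∏ i, (X - C (∑ j, (d i j : ℂ) * θ ^ (j : ℕ))) := by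
  classical
  set F := auxPoly a c m n k with hFdef
  obtain ⟨hmon, hdeg⟩ : F.Monic ∧ F.natDegree = k * m := auxPoly_monic_natDegree a c hkm
  have hA : IsIntegrallyClosed (aeval (R := ℤ) θ).range :=
    isIntegrallyClosed_adjoin_of_notMem_sq hmon hθ fun p hp I hI hpI =>
      auxPoly_notMem_sq a c hn hkm hcond hp hpI
  have hmapmap : (F.map (Int.castRingHom ℚ)).map (algebraMap ℚ ℂ) = F.map (Int.castRingHom ℂ) := by
    rw [Polynomial.map_map]
    congr 1
  have hroot : ∀ β ∈ (F.map (Int.castRingHom ℂ)).roots, ∃ d : Fin (k * m) → ℤ,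
      β = ∑ j, (d j : ℂ) * θ ^ (j : ℕ) := by
    intro β hβ
    have hβ0 : aeval β F = 0 := by
      have := (mem_roots'.1 hβ).2
      rwa [IsRoot.def, eval_map] at this
    have hβK : β ∈ IntermediateField.adjoin ℚ ({θ} : Set ℂ) := by
      refine (IntermediateField.splits_iff_mem (p := F.map (Int.castRingHom ℚ))
        (IsAlgClosed.splits _)).1 hsplit.splits β ?_
      rw [rootSet_def, aroots_def, hmapmap, Finset.mem_coe, Multiset.mem_toFinset]
      exact hβ
    obtain ⟨q, hq⟩ := mem_range_aeval_of_isIntegral hA hβK ⟨F, hmon, hβ0⟩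
    -- Division by the monic F stays over ℤ and leaves degree below km without changing the value at
    -- θ.
    refine ⟨fun j => (q %ₘ F).coeff j, ?_⟩
    have h1 : aeval θ (q %ₘ F) = β := by
      have := congrArg (aeval θ) (modByMonic_add_div q F)
      rw [map_add, map_mul, hθ, zero_mul, add_zero] at this
      rw [this]
      exact hq
    have h2 : (q %ₘ F).natDegree < k * m :=
      hdeg ▸ natDegree_modByMonic_lt q hmon (fun h => by rw [h, natDegree_one] at hdeg; omega)
    rw [← h1, aeval_eq_sum_range' h2, Finset.sum_range]
    simp
  have hmonC : (F.map (Int.castRingHom ℂ)).Monic := hmon.map _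
  have hsep : (F.map (Int.castRingHom ℂ)).Separable := by
    rw [← hmapmap]
    exact (Irreducible.separable hirr).map
  have hnodup := nodup_roots hsep
  have hprod := (IsAlgClosed.splits (F.map (Int.castRingHom ℂ))).eq_prod_roots_of_monic hmonC
  set R := (F.map (Int.castRingHom ℂ)).roots
  have hcard : R.toFinset.card = k * m := by
    rw [Multiset.toFinset_card_of_nodup hnodup,
      ← (IsAlgClosed.splits (F.map (Int.castRingHom ℂ))).natDegree_eq_card_roots,
      hmon.natDegree_map, hdeg]
  let e : Fin (k * m) ≃ R.toFinset := (R.toFinset.equivFinOfCardEq hcard).symm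
  choose d hd using fun i => hroot (e i) (Multiset.mem_toFinset.1 (e i).2)
  refine ⟨d, fun i j hij => ?_, ?_⟩
  · simp only [← hd] at hij
    exact e.injective (Subtype.ext hij)
  · simp only [← hd]
    rw [Equiv.prod_comp e (fun x : R.toFinset => (X - C (x : ℂ))), hprod,
      Finset.prod_coe_sort R.toFinset (fun x => X - C x), Finset.prod, Multiset.toFinset_val,
      hnodup.dedup]

theorem theorem2p11 (a c : ℤ) (m n k : ℕ) (hn : 1 ≤ n) (hkm : n < k * m)
    (hirr : Irreducible ((auxPoly a c m n k).map (Int.castRingHom ℚ)))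
    (θ : ℂ) (hθ : aeval θ (auxPoly a c m n k) = 0)
    (hsplit : IsSplittingField ℚ (IntermediateField.adjoin ℚ ({θ} : Set ℂ))
      ((auxPoly a c m n k).map (Int.castRingHom ℚ)))
    (hcond : ∀ p : ℕ, p.Prime → (p : ℤ) ∣ (auxPoly a c m n k).discr →
      SatisfiesCond a c m n k p) :
    ∃ d : Fin (k * m) → Fin (k * m) → ℤ,
      -- the numbers `∑ j, d i j * θ ^ j` are exactly the roots
      (auxPoly a c m n k).map (Int.castRingHom ℂ) =
        ∏ i, (X - C (∑ j, (d i j : ℂ) * θ ^ (j : ℕ))) ∧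
      -- general complex-valued solution
      (∀ y : ℝ → ℂ, IsODESolution a c m n k y ↔
        ∃ α : Fin (k * m) → ℂ, ∀ x : ℝ,
          y x = ∑ i, α i * ∏ j, Complex.exp ((d i j : ℂ) * θ ^ (j : ℕ) * (x : ℂ))) ∧
      -- general real-valued solution when `θ` (hence every root) is real
      (∀ ϑ : ℝ, (ϑ : ℂ) = θ → ∀ y : ℝ → ℝ, IsODESolution a c m n k y ↔
        ∃ α : Fin (k * m) → ℝ, ∀ x : ℝ,
          y x = ∑ i, α i * ∏ j, Real.exp ((d i j : ℝ) * ϑ ^ (j : ℕ) * x)) := by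
  obtain ⟨d, hinj, hprod⟩ := exists_int_coords_of_roots hn hkm hirr hθ hsplit hcond
  refine ⟨d, hprod, fun y => ?_, ?_⟩
  · simp only [← Complex.exp_sum, ← Finset.sum_mul]
    refine isODESolution_iff_exists_sum (e := fun r x => Complex.exp (r * x)) (fun r x => ?_)
      (by simp) (by omega) hinj hprod
    have h1 : HasDerivAt (fun x : ℝ => r * (x : ℂ)) r x := by
      simpa using (Complex.ofRealCLM.hasDerivAt (x := x)).const_mul r
    simpa [mul_comm] using h1.cexp
  · rintro ϑ rfl y
    have hcast : ∀ i, (∑ j, (d i j : ℂ) * (ϑ : ℂ) ^ (j : ℕ)) =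
        ((∑ j, (d i j : ℝ) * ϑ ^ (j : ℕ) : ℝ) : ℂ) := fun i => by push_cast; rfl
    simp only [hcast] at hinj hprod
    simp only [← Real.exp_sum, ← Finset.sum_mul]
    refine isODESolution_iff_exists_sum (e := fun r x => Real.exp (r * x)) (fun r x => ?_)
      (by simp) (by omega) (fun i j hij => hinj (congrArg _ hij)) ?_
    · have h1 : HasDerivAt (fun x : ℝ => r * x) r x := by
        simpa using (hasDerivAt_id x).const_mul r
      simpa [mul_comm] using h1.exp
    -- The factorization descends from ℂ because all the roots are now real.
    · apply map_injective Complex.ofRealHom Complex.ofReal_injective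
      rw [Polynomial.map_map, Polynomial.map_prod,
        show Complex.ofRealHom.comp (Int.castRingHom ℝ) = Int.castRingHom ℂ from
          RingHom.ext_int _ _, hprod]
      simp only [Polynomial.map_sub, map_X, map_C, Complex.ofRealHom_eq_coe]
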